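/- **Definitions.** A suspension $P$ with an $n$-gonal equator is given by points $N,S,p_1,\dots,p_n\in\mathbb R^3$ (indices modulo $n$); its edges are $Np_j$, $Sp_j$, $p_jp_{j+1}$. Two suspensions with $n$-gonal equators are *isometric* if corresponding edges have equal lengths, and *congruent* if an isometry of $\mathbb R^3$ carries each vertex of one to the corresponding vertex of the other. $P$ *flexes* (is flexible) if there is a continuous family $P_t$, $0\le t\le 1$, of suspensions isometric to $P_0=P$ such that some $P_t$ is not congruent to $P_0$. Put $x=|N-S|^2$, $e_j=N-p_j$, $R=N-S$. On the cubic $y^2=x(x-51)(x-100)$, with its group law whose zero is the point at infinity, let $$A=(2,98),\quad B=\left(\tfrac{4039540}{762129},\tfrac{100768585960}{665338617}\right),\quad C=(102,-102),\quad D=(30,-210),$$ $$(Q_1,\dots,Q_6)=(-A+B-C,\ -A+2B-C-D,\ 2B-C-2D,\ A+B-C-2D,\ A-C-D,\ -C),$$ $$(Q'_1,\dots,Q'_6)=(-B,\ D,\ -A,\ B,\ -D,\ A).$$ Consider the numbers | $j$ | $\ell_j$ | $\ell'_j$ | $\ell_{j,j+1}$ | $\varepsilon_{j,j+1}$ | |---|---|---|---|---|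 | 1 | $\frac12\left(\frac{1436\sqrt{15}}{541}+\frac{218\sqrt{85}}{873}\right)$ | $\frac12\left(\frac{1436\sqrt{15}}{541}-\frac{218\sqrt{85}}{873}\right)$ | $\frac{541419683182996345}{29669606628505029}$ | $-1$ | | 2 | $\frac12\left(\frac{182493018091\sqrt{170}}{62820339553}-\sqrt{30}\right)$ | $\frac12\left(\frac{182493018091\sqrt{170}}{62820339553}+\sqrt{30}\right)$ | $\frac{31635727886833754300}{1435086871311616559}$ | $+1$ | | 3 | $\frac12\left(\frac{31054297\sqrt{102}}{22844303}-\sqrt2\right)$ | $\frac12\left(\frac{31054297\sqrt{102}}{22844303}+\sqrt2\right)$ | $\frac{27288800741}{19943076519}$ | $+1$ | | 4 | $\frac12\left(4\sqrt{15}-\frac{218\sqrt{85}}{873}\right)$ | $\frac12\left(4\sqrt{15}+\frac{218\sqrt{85}}{873}\right)$ | $\frac{130585}{9603}$ | $-1$ | | 5 | $\frac12\left(\frac{17\sqrt{170}}{11}-\sqrt{30}\right)$ | $\frac12\left(\frac{17\sqrt{170}}{11}+\sqrt{30}\right)$ | $\frac{100}{11}$ | $+1$ | | 6 | $\frac12(\sqrt{102}+\sqrt2)$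 | $\frac12(\sqrt{102}-\sqrt2)$ | $\frac{310327}{472293}$ | $-1$ | Call a suspension with a hexagonal equator a *position of $\mathcal S$* if $|N-p_j|=\ell_j$, $|p_j-S|=\ell'_j$, $|p_j-p_{j+1}|=\ell_{j,j+1}$ for $j=1,\dots,6$, and if for some $\sigma\in\{-1,0,1\}$ the sign of $(e_j\times e_{j+1})\cdot R$ equals $\sigma\varepsilon_{j,j+1}$ for all $j$ ($\sigma=-1$ allows for a reflection of space, $\sigma=0$ for flat positions). A suspension with a hexagonal equator is a *subdivided Bricard octahedron* if it arises from a flexible suspension with a quadrilateral equator by performing twice the operation: choose an interior point of an edge of the equator, make it a new vertex of the equator, and join it to both poles. It is a *doubly covered star* if it arises from a suspension by replacing the star of the south pole by a second copy of the star of the north pole (so that both poles coincide). **Theorem.** 1. For $j=1,\dots,6$, the points $Q_j$ and $Q'_j$ are finite and have the abscissas $(\ell_j+\ell'_j)^2$ and $(\ell_j-\ell'_j)^2$, respectively; and the values of $|N-S|^2$, over all pairs of triangles $Np_jp_{j+1}$, $Sp_jp_{j+1}$ in $\mathbb R^3$ with common side $p_jp_{j+1}$ and side lengths $\ell_j,\ell_{j+1},\ell_{j,j+1}$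 and $\ell'_j,\ell'_{j+1},\ell_{j,j+1}$, form the interval $[51,100]$. 2. $\mathcal S$ exists and flexes: there are positions of $\mathcal S$; each of them is a flexible suspension, and for each of them there is a continuous family $P_t$, $0\le t\le1$, of positions of $\mathcal S$ starting at it along which the set of values of $x$ is exactly $[51,100]$. 3. $\mathcal S$ is non-trivial, and $x$ stays in $[51,100]$: every suspension isometric to a position of $\mathcal S$ has $x\in[51,100]$, is not a subdivided Bricard octahedron, and is not a doubly covered star. -/

import Mathlib

open scoped Matrix

namespace FlexSusp

/-- Euclidean 3-space. -/
abbrev E3 := EuclideanSpace ℝ (Fin 3)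

/-! ### Polyhedra, congruence, isometry, flexibility

A polyhedron is a map of a simplicial complex to `E3`, linear on each simplex, hence is given by the
images of the vertices. Congruence only involves the vertices, isometry only the vertices and the
edges, so the complex enters through its graph of edges `K`. -/

/-- Two polyhedra are congruent if an isometry of space carries one to the other. -/
def Congruent {V : Type} (P Q : V → E3) : Prop :=
  ∃ A : E3 ≃ᵢ E3, ∀ v, Q v = A (P v)

/-- Two polyhedra are isometric if corresponding edges have equal lengths. -/
def Isometric {V : Type} (K : SimpleGraph V) (P Q : V → E3) : Prop :=
  ∀ u v, K.Adj u v → dist (P u) (P v) = dist (Q u) (Q v)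

/-- `γ` is a continuous isometric deformation, over the parameter interval `[0, 1]`, of `P`. -/
def IsIsometricDeformation {V : Type} (K : SimpleGraph V) (P : V → E3)
    (γ : unitInterval → V → E3) : Prop :=
  Continuous γ ∧ γ 0 = P ∧ ∀ t, Isometric K (γ 0) (γ t)

/-- A polyhedron is flexible if it has a continuous isometric deformation some member of which is
not congruent to it. -/
def Flexible {V : Type} (K : SimpleGraph V) (P : V → E3) : Prop :=
  ∃ γ, IsIsometricDeformation K P γ ∧ ∃ t, ¬ Congruent (γ 0) (γ t)

/-! ### Suspensions -/

/-- Vertices of a suspension over an `n`-gon: two poles and `n` vertices of the equator. -/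
inductive SuspVertex (n : ℕ) : Type
  | north : SuspVertex n
  | south : SuspVertex n
  | equator (j : Fin n) : SuspVertex n

/-- Each pole is joined to each vertex of the equator. -/
def poleEdge {n : ℕ} : SuspVertex n → SuspVertex n → Prop
  | .north, .equator _ => True
  | .south, .equator _ => True
  | _, _ => False

/-- The vertices of the equator form a cycle (addition in `Fin n` is modulo `n`). -/
def equatorEdge {n : ℕ} [NeZero n] : SuspVertex n → SuspVertex n → Prop
  | .equator i, .equator j => j = i + 1
  | _, _ => False

/-- The graph of edges of the suspension over an `n`-gon. -/
def suspGraph (n : ℕ) [NeZero n] : SimpleGraph (SuspVertex n) :=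
  SimpleGraph.fromRel fun u v => poleEdge u v ∨ equatorEdge u v

/-- A suspension with an `n`-gonal equator in space. -/
abbrev Suspension (n : ℕ) := SuspVertex n → E3

namespace Suspension

variable {n : ℕ}

/-- The north pole. -/
def N (P : Suspension n) : E3 := P .north

/-- The south pole. -/
def S (P : Suspension n) : E3 := P .south

/-- The vertices of the equator. -/
def p (P : Suspension n) (j : Fin n) : E3 := P (.equator j)

/-- The squared distance between the poles. -/
noncomputable def poleSq (P : Suspension n) : ℝ := dist P.N P.S ^ 2

/-- The sign of `(e_j × e_{j+1}) · R`, where `e_j = N - p_j` and `R = N - S`. -/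
noncomputable def orient [NeZero n] (P : Suspension n) (j : Fin n) : SignType :=
  SignType.sign (((P.N - P.p j).ofLp ⨯₃ (P.N - P.p (j + 1)).ofLp) ⬝ᵥ (P.N - P.S).ofLp)

end Suspension

/-! ### The two kinds of trivial flexible suspensions -/

/-- `P` arises from `Q` by choosing an interior point of an edge of the equator and joining it to
both poles. The new vertex is `P.p k`; deleting it and reading the equator of `P` cyclically from
`k + 1` on gives the equator of `Q`. -/
def IsEdgeSubdivision {n : ℕ} [NeZero n] (Q : Suspension n) (P : Suspension (n + 1)) : Prop :=
  P.N = Q.N ∧ P.S = Q.S ∧ ∃ k : Fin (n + 1),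
    P.p k ∈ openSegment ℝ (P.p (k - 1)) (P.p (k + 1)) ∧
    ∀ i : Fin n, Q.p i = P.p (k + 1 + i.castSucc)

/-- `P` arises from a flexible octahedron, i.e. a flexible suspension with a quadrilateral equator,
by subdividing edges of the equator twice. -/
def IsSubdividedBricard (P : Suspension 6) : Prop :=
  ∃ O : Suspension 4, Flexible (suspGraph 4) O ∧
    ∃ M : Suspension 5, IsEdgeSubdivision O M ∧ IsEdgeSubdivision M P

/-- The star of the north pole of `Q`, covered twice: the star of the south pole is replaced by a
second copy of the star of the north pole. -/
def doubledStar {n : ℕ} (Q : Suspension n) : Suspension n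
  | .south => Q.N
  | .north => Q.N
  | .equator j => Q.p j

/-- `P` is the star of the north pole of some suspension, covered twice. -/
def IsDoublyCoveredStar {n : ℕ} (P : Suspension n) : Prop :=
  ∃ Q : Suspension n, P = doubledStar Q

/-! ### The cubic `y² = x (x - 51) (x - 100)` and its points -/

/-- The cubic `y² = x (x - 51) (x - 100) = x³ - 151 x² + 5100 x`. -/
noncomputable def cubic : WeierstrassCurve.Affine ℝ where
  a₁ := 0
  a₂ := -151
  a₃ := 0
  a₄ := 5100
  a₆ := 0

theorem cubic_nonsingular {x y : ℝ} (h : y ^ 2 = x * (x - 51) * (x - 100)) (hy : y ≠ 0) :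
    cubic.Nonsingular x y := by
  rw [WeierstrassCurve.Affine.nonsingular_iff, WeierstrassCurve.Affine.equation_iff]
  refine ⟨?_, Or.inr ?_⟩
  · simp only [cubic]
    linarith
  · simp only [cubic]
    intro h'
    exact hy (by linarith)

/-- The point `A`. -/
noncomputable def ptA : cubic.Point :=
  .some 2 98 (cubic_nonsingular (by norm_num) (by norm_num))

/-- The point `B`. -/
noncomputable def ptB : cubic.Point :=
  .some (4039540 / 762129) (100768585960 / 665338617)
    (cubic_nonsingular (by norm_num) (by norm_num))

/-- The point `C`. -/
noncomputable def ptC : cubic.Point :=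
  .some 102 (-102) (cubic_nonsingular (by norm_num) (by norm_num))

/-- The point `D`. -/
noncomputable def ptD : cubic.Point :=
  .some 30 (-210) (cubic_nonsingular (by norm_num) (by norm_num))

/-- The points `Q_j`, computed in the group of the cubic; their abscissas are the `r_j`. -/
noncomputable def ptQ : Fin 6 → cubic.Point :=
  ![-ptA + ptB - ptC,
    -ptA + 2 • ptB - ptC - ptD,
    2 • ptB - ptC - 2 • ptD,
    ptA + ptB - ptC - 2 • ptD,
    ptA - ptC - ptD,
    -ptC]

/-- The points `Q'_j`; their abscissas are the `r'_j`. -/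
noncomputable def ptQ' : Fin 6 → cubic.Point :=
  ![-ptB, ptD, -ptA, ptB, -ptD, ptA]

/-- `q` is a finite point of the cubic with abscissa `r`. -/
def HasAbscissa (q : cubic.Point) (r : ℝ) : Prop :=
  ∃ (y : ℝ) (h : cubic.Nonsingular r y), q = .some r y h

/-! ### The edge lengths and the signs. Index `j : Fin 6` stands for the vertex `p_{j+1}`. -/

/-- The lengths `|N - p_j|`. -/
noncomputable def lenN : Fin 6 → ℝ :=
  ![(1436 * √15 / 541 + 218 * √85 / 873) / 2,
    (182493018091 * √170 / 62820339553 - √30) / 2,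
    (31054297 * √102 / 22844303 - √2) / 2,
    (4 * √15 - 218 * √85 / 873) / 2,
    (17 * √170 / 11 - √30) / 2,
    (√102 + √2) / 2]

/-- The lengths `|p_j - S|`. -/
noncomputable def lenS : Fin 6 → ℝ :=
  ![(1436 * √15 / 541 - 218 * √85 / 873) / 2,
    (182493018091 * √170 / 62820339553 + √30) / 2,
    (31054297 * √102 / 22844303 + √2) / 2,
    (4 * √15 + 218 * √85 / 873) / 2,
    (17 * √170 / 11 + √30) / 2,
    (√102 - √2) / 2]

/-- The lengths `|p_j - p_{j+1}|`. -/
noncomputable def lenE : Fin 6 → ℝ :=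
  ![541419683182996345 / 29669606628505029,
    31635727886833754300 / 1435086871311616559,
    27288800741 / 19943076519,
    130585 / 9603,
    100 / 11,
    310327 / 472293]

/-- The signs `ε_{j,j+1}`. -/
def eps : Fin 6 → SignType := ![-1, 1, 1, -1, 1, -1]

/-- The squared pole distances that occur for the `j`-sector, i.e. for two triangles
`N p_j p_{j+1}` and `S p_j p_{j+1}` with the prescribed side lengths and a common side. The minimum
and the maximum of this set are the branching points of the sector. -/
def sectorPoleSq (j : Fin 6) : Set ℝ :=
  {x | ∃ N S p q : E3, dist N p = lenN j ∧ dist N q = lenN (j + 1) ∧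
    dist S p = lenS j ∧ dist S q = lenS (j + 1) ∧ dist p q = lenE j ∧ x = dist N S ^ 2}

/-- `P` is a position of the constructed suspension: it has the prescribed edge lengths, and the
signs of `(e_j × e_{j+1}) · R` are the prescribed signs `ε_{j,j+1}`, up to a reflection of space
(`σ = -1`) and except that all of them vanish in a flat position (`σ = 0`). -/
def IsConstructed (P : Suspension 6) : Prop :=
  (∀ j, dist P.N (P.p j) = lenN j ∧ dist (P.p j) P.S = lenS j ∧
    dist (P.p j) (P.p (j + 1)) = lenE j) ∧
  ∃ σ : SignType, ∀ j, P.orient j = σ * eps j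

end FlexSusp

open FlexSusp

namespace FlexSusp

/-! ### Arithmetic of the edge lengths -/

/-! Project the spokes `e_j = N - p_j` to the plane orthogonal to `R = N - S` and scale by `√x`,
where `x = |R|²`. Identifying this plane with `ℂ`, one gets numbers `ζ_j` with `|ζ_j|² = radSq j x`.
The edge lengths fix the real part of `conj ζ_j * ζ_{j+1}` as `sectorPoly j x`; by `sectorPoly_sq`
and `sectorCoeff_sq`, its imaginary part is `± sectorCoeff j * w` with `w² = -x (x - 51) (x - 100)`.
All six sectors thus need the same square root. A suspension closes up when the product of the six
numbers `sectorPoly j x + i * sectorCoeff j * w` is the positive real `∏ radSq j x`.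

With `y = i w` the factors become functions `F_j` on the cubic, and closing up for all `x` is the
identity `∏ F_j = ∏ radSq j` of functions there (`prod_sectorRot`). Its source is the relation `Q_j
- Q_{j+1} = Q'_j + Q'_{j+1}`: `F_j` vanishes at `Q_j`, `-Q_{j+1}`, `-Q'_j`, `-Q'_{j+1}`, whose sum
is zero. Around the equator the `Q`-terms pair up as `±Q_j`, and the multiset of the `Q'_j` is
invariant under negation, so both sides have the same divisor and the same leading term. The code
checks the resulting polynomial identities in `x` directly.

On `[51, 100]` the number `w` is real and every `radSq j x` is positive, so `zeta` gives a
continuous family of positions. Conversely, a Gram determinant confines `x` to this interval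
(`IsSector.poleSq_mem`), and every position is a rotated and translated standard one
(`exists_eq_position`); moving `x` then gives the flex. Non-triviality depends only on lengths:
Stewart's relation fails at each equator vertex, and `ℓ_j ≠ ℓ'_j` keeps the poles apart. -/

/-- The abscissas `(ℓ_j + ℓ'_j)²`. -/
noncomputable def sumSq : Fin 6 → ℝ :=
  ![30931440 / 292681, 5661629280833549058327770 / 3946395061554216239809,
    98365674940749318 / 521862179555809, 240, 49130 / 121, 102]

/-- The abscissas `(ℓ_j - ℓ'_j)²`. -/
noncomputable def diffSq : Fin 6 → ℝ :=
  ![4039540 / 762129, 30, 2, 4039540 / 762129, 30, 2]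

/-- The rational coefficients of `ℓ_j² - ℓ'_j² = (ℓ_j + ℓ'_j) (ℓ_j - ℓ'_j)` with respect to `√51`. -/
noncomputable def prodCoeff : Fin 6 → ℝ :=
  ![1565240 / 472293, -1824930180910 / 62820339553, -62108594 / 22844303, -4360 / 873, -170 / 11, 2]

theorem lenN_add_lenS_sq (j : Fin 6) : (lenN j + lenS j) ^ 2 = sumSq j := by
  have h15 : √(15 : ℝ) ^ 2 = 15 := Real.sq_sqrt (by norm_num)
  have h170 : √(170 : ℝ) ^ 2 = 170 := Real.sq_sqrt (by norm_num)
  have h102 : √(102 : ℝ) ^ 2 = 102 := Real.sq_sqrt (by norm_num)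
  fin_cases j <;> simp only [lenN, lenS, sumSq, Fin.reduceFinMk, Fin.zero_eta, Fin.mk_one,
    Matrix.cons_val] <;> ring_nf <;> norm_num [h15, h170, h102]

theorem lenN_sub_lenS_sq (j : Fin 6) : (lenN j - lenS j) ^ 2 = diffSq j := by
  have h85 : √(85 : ℝ) ^ 2 = 85 := Real.sq_sqrt (by norm_num)
  have h30 : √(30 : ℝ) ^ 2 = 30 := Real.sq_sqrt (by norm_num)
  have h2 : √(2 : ℝ) ^ 2 = 2 := Real.sq_sqrt (by norm_num)
  fin_cases j <;> simp only [lenN, lenS, diffSq, Fin.reduceFinMk, Fin.zero_eta, Fin.mk_one,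
    Matrix.cons_val] <;> ring_nf <;> norm_num [h85, h30, h2]

theorem sqrt_mul_sqrt_eq_mul_sqrt {a b c d : ℝ} (ha : 0 ≤ a) (hc : 0 ≤ c) (h : a * b = c ^ 2 * d) :
    √a * √b = c * √d := by
  rw [← Real.sqrt_mul ha, h, Real.sqrt_mul (sq_nonneg c), Real.sqrt_sq hc]

/-- The radicands multiply to `15 * 85 = 5² * 51`, `170 * 30 = 10² * 51`, `102 * 2 = 2² * 51`. A
single irrationality `√51` therefore serves all `j`, and it cancels from `radSq` and `sectorPoly`.
-/
theorem lenN_sq_sub_lenS_sq (j : Fin 6) : lenN j ^ 2 - lenS j ^ 2 = prodCoeff j * √51 := by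
  have h1 : √(15 : ℝ) * √85 = 5 * √51 :=
    sqrt_mul_sqrt_eq_mul_sqrt (by norm_num) (by norm_num) (by norm_num)
  have h2 : √(170 : ℝ) * √30 = 10 * √51 :=
    sqrt_mul_sqrt_eq_mul_sqrt (by norm_num) (by norm_num) (by norm_num)
  have h3 : √(102 : ℝ) * √2 = 2 * √51 :=
    sqrt_mul_sqrt_eq_mul_sqrt (by norm_num) (by norm_num) (by norm_num)
  fin_cases j <;> simp only [lenN, lenS, prodCoeff, Fin.reduceFinMk, Fin.zero_eta, Fin.mk_one,
    Matrix.cons_val]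
  · linear_combination (1436 / 541 * (218 / 873) : ℝ) * h1
  · linear_combination (-182493018091 / 62820339553 : ℝ) * h2
  · linear_combination (-31054297 / 22844303 : ℝ) * h3
  · linear_combination (-4 * (218 / 873) : ℝ) * h1
  · linear_combination (-17 / 11 : ℝ) * h2
  · linear_combination h3

theorem lenN_sq (j : Fin 6) :
    lenN j ^ 2 = (sumSq j + diffSq j) / 4 + prodCoeff j * √51 / 2 := by
  linear_combination (lenN_add_lenS_sq j + lenN_sub_lenS_sq j) / 4 + lenN_sq_sub_lenS_sq j / 2

theorem lt_sumSq (j : Fin 6) : 100 < sumSq j := by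
  fin_cases j <;> simp only [sumSq, Fin.reduceFinMk, Fin.zero_eta, Fin.mk_one, Matrix.cons_val] <;>
    norm_num

theorem diffSq_lt (j : Fin 6) : diffSq j < 51 := by
  fin_cases j <;> simp only [diffSq, Fin.reduceFinMk, Fin.zero_eta, Fin.mk_one, Matrix.cons_val] <;>
    norm_num

theorem prodCoeff_ne_zero (j : Fin 6) : prodCoeff j ≠ 0 := by
  fin_cases j <;> simp only [prodCoeff, Fin.reduceFinMk, Fin.zero_eta, Fin.mk_one,
    Matrix.cons_val] <;> norm_num

theorem prodCoeff_sq (j : Fin 6) : 51 * prodCoeff j ^ 2 = sumSq j * diffSq j := by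
  fin_cases j <;> simp only [prodCoeff, sumSq, diffSq, Fin.reduceFinMk, Fin.zero_eta, Fin.mk_one,
    Matrix.cons_val] <;> norm_num

theorem lenE_pos (j : Fin 6) : 0 < lenE j := by
  fin_cases j <;> simp only [lenE, Fin.reduceFinMk, Fin.zero_eta, Fin.mk_one, Matrix.cons_val] <;>
    norm_num

theorem lenN_add_lenS_nonneg (j : Fin 6) : 0 ≤ lenN j + lenS j := by
  fin_cases j <;> simp only [lenN, lenS, Fin.reduceFinMk, Fin.zero_eta, Fin.mk_one,
    Matrix.cons_val] <;> ring_nf <;> positivity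

theorem abs_lenN_sub_lenS_lt (j : Fin 6) : |lenN j - lenS j| < lenN j + lenS j := by
  refine abs_lt_of_sq_lt_sq ?_ (lenN_add_lenS_nonneg j)
  rw [lenN_add_lenS_sq, lenN_sub_lenS_sq]
  linarith [lt_sumSq j, diffSq_lt j]

theorem lenN_pos (j : Fin 6) : 0 < lenN j := by
  linarith [(abs_lt.mp (abs_lenN_sub_lenS_lt j)).1]

theorem lenS_pos (j : Fin 6) : 0 < lenS j := by
  linarith [(abs_lt.mp (abs_lenN_sub_lenS_lt j)).2]

/-! ### The polynomials of a vertex and of a sector -/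

/-- With `e_j = N - p_j` and `R = N - S`, this is `|R|² |e_j|² - (e_j · R)²`
as a polynomial in `x = |R|²`. -/
noncomputable def radSq (j : Fin 6) (x : ℝ) : ℝ := -((x - sumSq j) * (x - diffSq j)) / 4

/-- With `e_j = N - p_j` and `R = N - S`, this is `|R|² (e_j · e_{j+1}) - (e_j · R) (e_{j+1} · R)`
as a polynomial in `x = |R|²`. -/
noncomputable def sectorPoly (j : Fin 6) (x : ℝ) : ℝ :=
  -x ^ 2 / 4 + ((sumSq j + diffSq j + sumSq (j + 1) + diffSq (j + 1)) / 8 - lenE j ^ 2 / 2) * x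
    - 51 * prodCoeff j * prodCoeff (j + 1) / 4

/-- The right hand side of the equation of the cubic. -/
noncomputable def cubicPoly (x : ℝ) : ℝ := x * (x - 51) * (x - 100)

/-- The two roots lie on either side of `[51, 100]`. Geometrically, no vertex of the equator meets
the line through the poles, so every `ζ_j` may be divided by. -/
theorem radSq_pos (j : Fin 6) {x : ℝ} (hx : x ∈ Set.Icc (51 : ℝ) 100) : 0 < radSq j x := by
  have h1 := lt_sumSq j
  have h2 := diffSq_lt j
  have h3 : 0 < (sumSq j - x) * (x - diffSq j) :=
    mul_pos (by linarith [hx.2]) (by linarith [hx.1])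
  unfold radSq
  linarith

theorem sectorPoly_eq (x : ℝ) (j : Fin 6) : sectorPoly j x =
    ![-x ^ 2 / 4 + 903498111398058355 / 29669606628505029 * x
        + 51 / 4 * (1565240 / 472293 * (1824930180910 / 62820339553)),
      -x ^ 2 / 4 - 51790760803174576128 / 1435086871311616559 * x
        - 51 / 4 * (1824930180910 / 62820339553 * (62108594 / 22844303)),
      -x ^ 2 / 4 + 1067704290335 / 19943076519 * x - 51 / 4 * (62108594 / 22844303 * (4360 / 873)),
      -x ^ 2 / 4 - 6365 / 873 * x - 51 / 4 * (4360 / 873 * (170 / 11)),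
      -x ^ 2 / 4 + 288 / 11 * x + 51 / 4 * (170 / 11 * 2),
      -x ^ 2 / 4 + 12589945 / 472293 * x - 51 / 4 * (2 * (1565240 / 472293))] j := by
  unfold sectorPoly
  fin_cases j <;> simp only [prodCoeff, sumSq, diffSq, lenE, Fin.reduceFinMk, Fin.zero_eta,
    Fin.mk_one, Matrix.cons_val, Fin.reduceAdd, zero_add] <;> norm_num <;> ring

/-- The norm of the function `sectorPoly j x + lenE j / 2 * y` on the cubic. -/
theorem sectorPoly_sq (j : Fin 6) (x : ℝ) :
    sectorPoly j x ^ 2 = radSq j x * radSq (j + 1) x + lenE j ^ 2 / 4 * cubicPoly x := by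
  rw [sectorPoly_eq]
  unfold radSq cubicPoly
  fin_cases j <;> simp only [sumSq, diffSq, lenE, Fin.reduceFinMk, Fin.zero_eta,
    Fin.mk_one, Matrix.cons_val, Fin.reduceAdd, zero_add] <;> ring

/-! ### The closing identity on the cubic -/

/-- The coefficient of `1` in `(a₀ + b₀ y) (a₁ + b₁ y) (a₂ + b₂ y)`, where `y² = c`. -/
def tripleEven {R : Type*} [CommRing R] (c a₀ a₁ a₂ b₀ b₁ b₂ : R) : R :=
  a₀ * a₁ * a₂ + c * (a₀ * b₁ * b₂ + b₀ * a₁ * b₂ + b₀ * b₁ * a₂)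

/-- The coefficient of `y` in `(a₀ + b₀ y) (a₁ + b₁ y) (a₂ + b₂ y)`, where `y² = c`. -/
def tripleOdd {R : Type*} [CommRing R] (c a₀ a₁ a₂ b₀ b₁ b₂ : R) : R :=
  b₀ * a₁ * a₂ + a₀ * b₁ * a₂ + a₀ * a₁ * b₂ + c * (b₀ * b₁ * b₂)

theorem triple_mul {R : Type*} [CommRing R] {y c : R} (h : y ^ 2 = c) (a₀ a₁ a₂ b₀ b₁ b₂ : R) :
    (a₀ + b₀ * y) * (a₁ + b₁ * y) * (a₂ + b₂ * y) =
      tripleEven c a₀ a₁ a₂ b₀ b₁ b₂ + tripleOdd c a₀ a₁ a₂ b₀ b₁ b₂ * y := by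
  unfold tripleEven tripleOdd
  linear_combination (a₀ * b₁ * b₂ + b₀ * a₁ * b₂ + b₀ * b₁ * a₂ + b₀ * b₁ * b₂ * y) * h

/-- The coefficient of `y` in the function on the cubic attached to a sector. -/
noncomputable def sectorCoeff (j : Fin 6) : ℝ := (eps j : ℝ) * lenE j / 2

theorem sectorCoeff_eq (j : Fin 6) : sectorCoeff j =
    ![-541419683182996345 / 59339213257010058, 31635727886833754300 / 2870173742623233118,
      27288800741 / 39886153038, -130585 / 19206, 100 / 22, -310327 / 944586] j := by
  unfold sectorCoeff
  fin_cases j <;> simp [eps, lenE] <;> norm_num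

theorem sectorCoeff_sq (j : Fin 6) : sectorCoeff j ^ 2 = lenE j ^ 2 / 4 := by
  have h : (eps j : ℝ) ^ 2 = 1 := by fin_cases j <;> simp [eps]
  unfold sectorCoeff
  linear_combination lenE j ^ 2 / 4 * h

/-- This and `odd_part_eq` are the components at `1` and `y` of `∏ F_j = ∏ radSq j` in `ℝ[x] ⊕ ℝ[x]
y`. Grouping the six factors into two triples keeps the expansions manageable. -/
theorem even_part_eq (x : ℝ) :
    tripleEven (cubicPoly x) (sectorPoly 0 x) (sectorPoly 1 x) (sectorPoly 2 x)
        (sectorCoeff 0) (sectorCoeff 1) (sectorCoeff 2) *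
      tripleEven (cubicPoly x) (sectorPoly 3 x) (sectorPoly 4 x) (sectorPoly 5 x)
        (sectorCoeff 3) (sectorCoeff 4) (sectorCoeff 5) +
    cubicPoly x * (tripleOdd (cubicPoly x) (sectorPoly 0 x) (sectorPoly 1 x) (sectorPoly 2 x)
        (sectorCoeff 0) (sectorCoeff 1) (sectorCoeff 2) *
      tripleOdd (cubicPoly x) (sectorPoly 3 x) (sectorPoly 4 x) (sectorPoly 5 x)
        (sectorCoeff 3) (sectorCoeff 4) (sectorCoeff 5)) =
    radSq 0 x * radSq 1 x * radSq 2 x * (radSq 3 x * radSq 4 x * radSq 5 x) := by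
  simp only [sectorPoly_eq, sectorCoeff_eq, radSq, sumSq, diffSq, Matrix.cons_val, cubicPoly,
    tripleEven, tripleOdd]
  ring

theorem odd_part_eq (x : ℝ) :
    tripleEven (cubicPoly x) (sectorPoly 0 x) (sectorPoly 1 x) (sectorPoly 2 x)
        (sectorCoeff 0) (sectorCoeff 1) (sectorCoeff 2) *
      tripleOdd (cubicPoly x) (sectorPoly 3 x) (sectorPoly 4 x) (sectorPoly 5 x)
        (sectorCoeff 3) (sectorCoeff 4) (sectorCoeff 5) +
    tripleOdd (cubicPoly x) (sectorPoly 0 x) (sectorPoly 1 x) (sectorPoly 2 x)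
        (sectorCoeff 0) (sectorCoeff 1) (sectorCoeff 2) *
      tripleEven (cubicPoly x) (sectorPoly 3 x) (sectorPoly 4 x) (sectorPoly 5 x)
        (sectorCoeff 3) (sectorCoeff 4) (sectorCoeff 5) = 0 := by
  simp only [sectorPoly_eq, sectorCoeff_eq, Matrix.cons_val, cubicPoly, tripleEven, tripleOdd]
  ring

/-- The rotation of a sector about the axis through the poles, scaled by the distances of its
vertices from the axis and by `x = |N - S|²`, where `w² = -x (x - 51) (x - 100)`. -/
noncomputable def sectorRot (j : Fin 6) (x w : ℝ) : ℂ := ⟨sectorPoly j x, sectorCoeff j * w⟩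

theorem normSq_sectorRot (j : Fin 6) {x w : ℝ} (hw : w ^ 2 = -cubicPoly x) :
    Complex.normSq (sectorRot j x w) = radSq j x * radSq (j + 1) x := by
  rw [sectorRot, Complex.normSq_mk]
  linear_combination sectorPoly_sq j x + sectorCoeff j ^ 2 * hw - cubicPoly x * sectorCoeff_sq j

/-- The rotations of the six sectors compose to the identity. -/
theorem prod_sectorRot {x w : ℝ} (hw : w ^ 2 = -cubicPoly x) :
    sectorRot 0 x w * sectorRot 1 x w * sectorRot 2 x w *
      (sectorRot 3 x w * sectorRot 4 x w * sectorRot 5 x w) =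
    ((radSq 0 x * radSq 1 x * radSq 2 x * (radSq 3 x * radSq 4 x * radSq 5 x) : ℝ) : ℂ) := by
  have hF : ∀ j, sectorRot j x w = (sectorPoly j x : ℂ) + (sectorCoeff j : ℂ) * (w * Complex.I) :=
    fun j => by apply Complex.ext <;> simp [sectorRot]
  have hy : ((w : ℂ) * Complex.I) ^ 2 = (cubicPoly x : ℂ) := by
    have : (w : ℂ) ^ 2 = -(cubicPoly x : ℂ) := by exact_mod_cast hw
    rw [mul_pow, Complex.I_sq, this]
    ring
  simp only [hF]
  rw [triple_mul hy, triple_mul hy, ← even_part_eq]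
  have ho := congrArg (fun t : ℝ => (t : ℂ)) (odd_part_eq x)
  simp only [tripleEven, tripleOdd, Complex.ofReal_add, Complex.ofReal_mul,
    Complex.ofReal_zero] at ho ⊢
  generalize (w : ℂ) * Complex.I = y at hy ⊢
  -- The long coefficient is the product of the two odd parts: it multiplies `y²`, which has to be
  -- replaced by the cubic polynomial.
  linear_combination y * ho + (((sectorCoeff 0 : ℂ) * sectorPoly 1 x * sectorPoly 2 x +
      sectorPoly 0 x * sectorCoeff 1 * sectorPoly 2 x +
      sectorPoly 0 x * sectorPoly 1 x * sectorCoeff 2 +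
      cubicPoly x * (sectorCoeff 0 * sectorCoeff 1 * sectorCoeff 2)) *
    (sectorCoeff 3 * sectorPoly 4 x * sectorPoly 5 x +
      sectorPoly 3 x * sectorCoeff 4 * sectorPoly 5 x +
      sectorPoly 3 x * sectorPoly 4 x * sectorCoeff 5 +
      cubicPoly x * (sectorCoeff 3 * sectorCoeff 4 * sectorCoeff 5))) * hy

/-- No vertex of the equator lies on the segment between its neighbours: Stewart's relation fails. -/
theorem stewart_ne (j : Fin 6) :
    prodCoeff (j - 1) * lenE j + prodCoeff (j + 1) * lenE (j - 1) ≠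
      (lenE (j - 1) + lenE j) * prodCoeff j := by
  fin_cases j <;> simp [prodCoeff, lenE] <;> norm_num

/-! ### Addition on the cubic -/

/-- `q` is the finite point `(x, y)` of the cubic. -/
def IsPoint (q : cubic.Point) (x y : ℝ) : Prop :=
  ∃ h : cubic.Nonsingular x y, q = .some x y h

theorem IsPoint.neg {q : cubic.Point} {x y : ℝ} (h : IsPoint q x y) : IsPoint (-q) x (-y) := by
  obtain ⟨h, rfl⟩ := h
  have hy : cubic.negY x y = -y := by simp [WeierstrassCurve.Affine.negY, cubic]
  rw [← hy]
  exact ⟨_, WeierstrassCurve.Affine.Point.neg_some h⟩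

/-- The chord construction with the slope `m` supplied by the caller, so that each use is a check of
rational arithmetic. The `151` is `-a₂`. -/
theorem IsPoint.add {q₁ q₂ : cubic.Point} {x₁ y₁ x₂ y₂ x₃ y₃ : ℝ} (m : ℝ) (h₁ : IsPoint q₁ x₁ y₁)
    (h₂ : IsPoint q₂ x₂ y₂) (hx : x₁ ≠ x₂) (hm : m * (x₁ - x₂) = y₁ - y₂)
    (hx₃ : x₃ = m ^ 2 + 151 - x₁ - x₂) (hy₃ : y₃ = -(m * (x₃ - x₁) + y₁)) :
    IsPoint (q₁ + q₂) x₃ y₃ := by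
  obtain ⟨h₁, rfl⟩ := h₁
  obtain ⟨h₂, rfl⟩ := h₂
  have hs : cubic.slope x₁ x₂ y₁ y₂ = m := by
    rw [WeierstrassCurve.Affine.slope_of_X_ne hx, ← hm, mul_div_cancel_right₀ _ (sub_ne_zero.mpr hx)]
  have hX : cubic.addX x₁ x₂ (cubic.slope x₁ x₂ y₁ y₂) = x₃ := by
    rw [hs, hx₃]
    simp [WeierstrassCurve.Affine.addX, cubic]
  have hY : cubic.addY x₁ x₂ y₁ (cubic.slope x₁ x₂ y₁ y₂) = y₃ := by
    rw [WeierstrassCurve.Affine.addY, WeierstrassCurve.Affine.negAddY, hX, hs, hy₃]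
    simp [WeierstrassCurve.Affine.negY, cubic]
  have := WeierstrassCurve.Affine.Point.add_of_X_ne (h₁ := h₁) (h₂ := h₂) hx
  rw [this, ← hX, ← hY]
  exact ⟨_, rfl⟩

theorem IsPoint.hasAbscissa {q : cubic.Point} {x y : ℝ} (h : IsPoint q x y) : HasAbscissa q x :=
  ⟨y, h⟩

theorem isPoint_ptA : IsPoint ptA 2 98 := ⟨_, rfl⟩

theorem isPoint_ptB : IsPoint ptB (4039540 / 762129) (100768585960 / 665338617) := ⟨_, rfl⟩

theorem isPoint_ptC : IsPoint ptC 102 (-102) := ⟨_, rfl⟩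

theorem isPoint_ptD : IsPoint ptD 30 (-210) := ⟨_, rfl⟩

/-- The points `A - D`, `B - D`, `B - A` are, up to sign, all the sums `Q'_j + Q'_{j+1}`. They are
the steps from `Q_{j+1}` to `Q_j`, by which the `Q_j` are computed downwards from `Q_6 = -C`. -/
theorem isPoint_A_sub_D : IsPoint (ptA + -ptD) 135 (-630) :=
  isPoint_ptA.add 4 isPoint_ptD.neg (by norm_num) (by norm_num) (by norm_num) (by norm_num)

theorem isPoint_B_sub_D :
    IsPoint (ptB + -ptD)
      (9992838 / 82369)
      (-10081241094 / 23639903) :=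
  isPoint_ptB.add (593879 / 250551)
    isPoint_ptD.neg (by norm_num) (by norm_num) (by norm_num) (by norm_num)

theorem isPoint_B_sub_A :
    IsPoint (ptB + -ptA)
      (1562381887130 / 266766889)
      (-1927711058493740030 / 4357103598037) :=
  isPoint_ptB.add (1077738769 / 14258709)
    isPoint_ptA.neg (by norm_num) (by norm_num) (by norm_num) (by norm_num)

theorem isPoint_ptQ_five : IsPoint (ptQ 5) 102 102 := by
  simpa [ptQ] using isPoint_ptC.neg

theorem isPoint_ptQ_four :
    IsPoint (ptQ 4)
      (49130 / 121)
      (8840510 / 1331) := by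
  have h : ptQ 4 = ptQ 5 + (ptA + -ptD) := by
    simp only [ptQ, Matrix.cons_val]
    abel
  rw [h]
  exact isPoint_ptQ_five.add (-244 / 11)
    isPoint_A_sub_D (by norm_num) (by norm_num) (by norm_num) (by norm_num)

theorem isPoint_ptQ_three :
    IsPoint (ptQ 3)
      240
      (-2520) := by
  have h : ptQ 3 = ptQ 4 + (ptB + -ptD) := by
    simp only [ptQ, Matrix.cons_val]
    abel
  rw [h]
  exact isPoint_ptQ_four.add (78377 / 3157)
    isPoint_B_sub_D (by norm_num) (by norm_num) (by norm_num) (by norm_num)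

theorem isPoint_ptQ_two :
    IsPoint (ptQ 2)
      (98365674940749318 / 521862179555809)
      (-18053411514039795685625754 / 11921577754013306206127) := by
  have h : ptQ 2 = ptQ 3 + (ptB + -ptA) := by
    simp only [ptQ, Matrix.cons_val]
    abel
  rw [h]
  exact isPoint_ptQ_three.add (-29222917478681 / 373116000899)
    isPoint_B_sub_A (by norm_num) (by norm_num) (by norm_num) (by norm_num)

theorem isPoint_ptQ_one :
    IsPoint (ptQ 1)
      (5661629280833549058327770 / 3946395061554216239809)
      (12760353764630956864568385268955559830 / 247913877777118200103588255865377) := by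
  have h : ptQ 1 = ptQ 2 + (-(ptA + -ptD)) := by
    simp only [ptQ, Matrix.cons_val]
    abel
  rw [h]
  exact isPoint_ptQ_two.add (-57531108288421042364 / 1435086871311616559)
    isPoint_A_sub_D.neg (by norm_num) (by norm_num) (by norm_num) (by norm_num)

theorem isPoint_ptQ_zero :
    IsPoint (ptQ 0)
      (30931440 / 292681)
      (28695544920 / 158340421) := by
  have h : ptQ 0 = ptQ 1 + (-(ptB + -ptD)) := by
    simp only [ptQ, Matrix.cons_val]
    abel
  rw [h]
  exact isPoint_ptQ_one.add (379104642911233889 / 9753925661375651)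
    isPoint_B_sub_D.neg (by norm_num) (by norm_num) (by norm_num) (by norm_num)

/-! ### The geometry of a sector -/

theorem dist_sq_eq_dotProduct (a b : E3) : dist a b ^ 2 = (a - b).ofLp ⬝ᵥ (a - b).ofLp := by
  rw [dist_eq_norm, EuclideanSpace.real_norm_sq_eq]
  simp [dotProduct, sq]

theorem radSq_eq (j : Fin 6) (x : ℝ) :
    radSq j x = x * lenN j ^ 2 - ((x + prodCoeff j * √51) / 2) ^ 2 := by
  have h51 : √(51 : ℝ) ^ 2 = 51 := Real.sq_sqrt (by norm_num)
  rw [lenN_sq, radSq]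
  linear_combination (prodCoeff j ^ 2 / 4) * h51 + prodCoeff_sq j / 4

theorem sectorPoly_eq_lengths (j : Fin 6) (x : ℝ) :
    sectorPoly j x = x * ((lenN j ^ 2 + lenN (j + 1) ^ 2 - lenE j ^ 2) / 2) -
      (x + prodCoeff j * √51) / 2 * ((x + prodCoeff (j + 1) * √51) / 2) := by
  have h51 : √(51 : ℝ) ^ 2 = 51 := Real.sq_sqrt (by norm_num)
  rw [lenN_sq, lenN_sq, sectorPoly]
  linear_combination (prodCoeff j * prodCoeff (j + 1) / 4) * h51

/-- The points `N`, `S`, `p`, `q` form the sector `j`. -/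
structure IsSector (j : Fin 6) (N S p q : E3) : Prop where
  north_left : dist N p = lenN j
  north_right : dist N q = lenN (j + 1)
  south_left : dist S p = lenS j
  south_right : dist S q = lenS (j + 1)
  edge : dist p q = lenE j

theorem dot_axis {N S p : E3} {j : Fin 6} (hN : dist N p = lenN j) (hS : dist S p = lenS j) :
    (N - p).ofLp ⬝ᵥ (N - S).ofLp = (dist N S ^ 2 + prodCoeff j * √51) / 2 := by
  have h1 := dist_sq_eq_dotProduct N p
  have h2 := dist_sq_eq_dotProduct S p
  rw [hN] at h1
  rw [hS] at h2
  rw [← lenN_sq_sub_lenS_sq, h1, h2, dist_sq_eq_dotProduct]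
  simp [dotProduct, Fin.sum_univ_three]
  ring

theorem dot_edge {N p q : E3} : (N - p).ofLp ⬝ᵥ (N - q).ofLp =
    (dist N p ^ 2 + dist N q ^ 2 - dist p q ^ 2) / 2 := by
  simp only [dist_sq_eq_dotProduct]
  simp [dotProduct, Fin.sum_univ_three]
  ring

/-- For the projections of `u` and `v` to the plane orthogonal to `r`, this is `(cross product)² =
|u|² |v|² - (u · v)²`, cleared of denominators. -/
theorem gram_identity (u v r : Fin 3 → ℝ) :
    r ⬝ᵥ r * ((u ⨯₃ v) ⬝ᵥ r) ^ 2 =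
      (r ⬝ᵥ r * (u ⬝ᵥ u) - (u ⬝ᵥ r) ^ 2) * (r ⬝ᵥ r * (v ⬝ᵥ v) - (v ⬝ᵥ r) ^ 2) -
        (r ⬝ᵥ r * (u ⬝ᵥ v) - u ⬝ᵥ r * (v ⬝ᵥ r)) ^ 2 := by
  simp [dotProduct, Fin.sum_univ_three, cross_apply]
  ring

/-- Coinciding poles would force `ℓ_j = ℓ'_j`, against `prodCoeff j ≠ 0`. -/
theorem dist_poles_pos {N S p : E3} {j : Fin 6} (hN : dist N p = lenN j)
    (hS : dist S p = lenS j) : 0 < dist N S := by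
  refine dist_pos.mpr fun h => ?_
  have h1 : lenN j = lenS j := by rw [← hN, ← hS, h]
  have h2 := lenN_sq_sub_lenS_sq j
  rw [h1, sub_self] at h2
  exact mul_ne_zero (prodCoeff_ne_zero j) (by positivity) h2.symm

namespace IsSector

variable {j : Fin 6} {N S p q : E3}

theorem dot_eq (h : IsSector j N S p q) : dist N S ^ 2 * ((N - p).ofLp ⬝ᵥ (N - q).ofLp) -
    (N - p).ofLp ⬝ᵥ (N - S).ofLp * ((N - q).ofLp ⬝ᵥ (N - S).ofLp) =
      sectorPoly j (dist N S ^ 2) := by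
  rw [dot_axis h.north_left h.south_left, dot_axis h.north_right h.south_right, dot_edge,
    sectorPoly_eq_lengths, h.north_left, h.north_right, h.edge]

/-- The Gram identity meets `sectorPoly_sq`: the products of `radSq` cancel and a factor `x > 0`
divides out. Nonnegativity of the left side is what confines `x` to `[51, 100]`. -/
theorem det_sq (h : IsSector j N S p q) :
    (((N - p).ofLp ⨯₃ (N - q).ofLp) ⬝ᵥ (N - S).ofLp) ^ 2 =
      -(lenE j ^ 2 / 4 * ((dist N S ^ 2 - 51) * (dist N S ^ 2 - 100))) := by
  have hx := pow_pos (dist_poles_pos h.north_left h.south_left) 2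
  refine mul_left_cancel₀ hx.ne' ?_
  have hg := gram_identity (N - p).ofLp (N - q).ofLp (N - S).ofLp
  rw [← dist_sq_eq_dotProduct N S, ← dist_sq_eq_dotProduct N p, ← dist_sq_eq_dotProduct N q,
    h.dot_eq, dot_axis h.north_left h.south_left, dot_axis h.north_right h.south_right,
    h.north_left, h.north_right, ← radSq_eq, ← radSq_eq, sectorPoly_sq] at hg
  rw [hg, cubicPoly]
  ring

theorem poleSq_mem (h : IsSector j N S p q) : dist N S ^ 2 ∈ Set.Icc (51 : ℝ) 100 := by
  have h1 : 0 ≤ -(lenE j ^ 2 / 4 * ((dist N S ^ 2 - 51) * (dist N S ^ 2 - 100))) :=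
    h.det_sq ▸ sq_nonneg _
  have h2 : 0 < lenE j ^ 2 / 4 := by have := lenE_pos j; positivity
  have h3 : (dist N S ^ 2 - 51) * (dist N S ^ 2 - 100) ≤ 0 := by
    by_contra! hc
    linarith [mul_pos h2 hc]
  constructor <;> nlinarith

end IsSector

/-! ### Points of the edges of the equator -/

/-- Stewart's theorem for a point on a segment. -/
theorem stewart {p a b : E3} (hp : p ∈ openSegment ℝ a b) (c : E3) :
    dist c a ^ 2 * dist p b + dist c b ^ 2 * dist a p =
      (dist a p + dist p b) * (dist c p ^ 2 + dist a p * dist p b) := by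
  obtain ⟨s, t, hs, ht, hst, rfl⟩ := hp
  have h1 : dist a (s • a + t • b) = t * dist a b := by
    have : a - (s • a + t • b) = t • (a - b) := by
      rw [← eq_sub_iff_add_eq] at hst
      subst hst
      module
    rw [dist_eq_norm, this, norm_smul, Real.norm_of_nonneg ht.le, dist_eq_norm]
  have h2 : dist (s • a + t • b) b = s * dist a b := by
    have : s • a + t • b - b = s • (a - b) := by
      rw [← eq_sub_iff_add_eq'] at hst
      subst hst
      module
    rw [dist_eq_norm, this, norm_smul, Real.norm_of_nonneg hs.le, dist_eq_norm]
  have h3 : dist c a ^ 2 * s + dist c b ^ 2 * t =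
      dist c (s • a + t • b) ^ 2 + s * t * dist a b ^ 2 := by
    obtain rfl : s = 1 - t := by linarith
    simp only [dist_sq_eq_dotProduct]
    simp [dotProduct, Fin.sum_univ_three]
    ring
  rw [h1, h2]
  linear_combination dist a b * h3 - dist a b * (dist c (s • a + t • b) ^ 2 +
    s * t * dist a b ^ 2) * hst

/-! ### The vertices of the equator in cylindrical coordinates about the axis -/

/-- The projection of `N - p_j` to the plane orthogonal to the axis, scaled by `√x`. -/
noncomputable def zeta (j : Fin 6) (x w : ℝ) : ℂ :=
  (√(radSq 0 x) : ℂ) * ∏ i ∈ Finset.univ.filter (· < j), sectorRot i x w / (radSq i x : ℂ)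

theorem zeta_zero (x w : ℝ) : zeta 0 x w = (√(radSq 0 x) : ℂ) := by
  simp [zeta]

/-- For `j ≠ 5` this is the recursion built into the product. For `j = 5` the index wraps around to
`0`, and the claim is that the equator closes, which is `prod_sectorRot`. -/
theorem zeta_succ (j : Fin 6) {x w : ℝ} (hx : x ∈ Set.Icc (51 : ℝ) 100)
    (hw : w ^ 2 = -cubicPoly x) :
    zeta (j + 1) x w = zeta j x w * (sectorRot j x w / (radSq j x : ℂ)) := by
  by_cases hj : j = 5
  · subst hj
    have h := prod_sectorRot hw
    have hr : ∀ i, (radSq i x : ℂ) ≠ 0 := fun i =>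
      Complex.ofReal_ne_zero.mpr (radSq_pos i hx).ne'
    have h5 : Finset.univ.filter (· < (5 : Fin 6)) = {0, 1, 2, 3, 4} := by decide
    rw [show (5 : Fin 6) + 1 = 0 from rfl, zeta_zero, zeta, h5]
    have := hr 0
    have := hr 1
    have := hr 2
    have := hr 3
    have := hr 4
    have := hr 5
    push_cast at h
    simp
    field_simp
    rw [eq_comm]
    linear_combination (√(radSq 0 x) : ℂ) * h
  · have hf : Finset.univ.filter (· < j + 1) = insert j (Finset.univ.filter (· < j)) := by
      revert j
      decide
    rw [zeta, zeta, hf, Finset.prod_insert (by simp)]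
    ring

theorem normSq_zeta (j : Fin 6) {x w : ℝ} (hx : x ∈ Set.Icc (51 : ℝ) 100)
    (hw : w ^ 2 = -cubicPoly x) : Complex.normSq (zeta j x w) = radSq j x := by
  have h0 : Complex.normSq (zeta 0 x w) = radSq 0 x := by
    rw [zeta_zero, Complex.normSq_ofReal, Real.mul_self_sqrt (radSq_pos 0 hx).le]
  have hs : ∀ i : Fin 6, Complex.normSq (zeta i x w) = radSq i x →
      Complex.normSq (zeta (i + 1) x w) = radSq (i + 1) x := by
    intro i hi
    have := (radSq_pos i hx).ne'
    rw [zeta_succ i hx hw, Complex.normSq_mul, Complex.normSq_div, normSq_sectorRot i hw, hi,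
      Complex.normSq_ofReal]
    field_simp
  have h1 := hs 0 h0
  have h2 := hs 1 h1
  have h3 := hs 2 h2
  have h4 := hs 3 h3
  have h5 := hs 4 h4
  fin_cases j <;> assumption

theorem zeta_ne_zero (j : Fin 6) {x w : ℝ} (hx : x ∈ Set.Icc (51 : ℝ) 100)
    (hw : w ^ 2 = -cubicPoly x) : zeta j x w ≠ 0 := by
  rw [← Complex.normSq_pos, normSq_zeta j hx hw]
  exact radSq_pos j hx

theorem conj_zeta_mul_zeta (j : Fin 6) {x w : ℝ} (hx : x ∈ Set.Icc (51 : ℝ) 100)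
    (hw : w ^ 2 = -cubicPoly x) :
    (starRingEnd ℂ) (zeta j x w) * zeta (j + 1) x w = sectorRot j x w := by
  have h : (radSq j x : ℂ) ≠ 0 := Complex.ofReal_ne_zero.mpr (radSq_pos j hx).ne'
  rw [zeta_succ j hx hw, ← mul_assoc, ← Complex.normSq_eq_conj_mul_self, normSq_zeta j hx hw]
  field_simp

theorem continuousOn_zeta (j : Fin 6) :
    ContinuousOn (fun a : ℝ × ℝ => zeta j a.1 a.2) {a | a.1 ∈ Set.Icc (51 : ℝ) 100} := by
  have hr : ∀ i, Continuous (radSq i) := fun i => by unfold radSq; fun_prop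
  have hF : ∀ i, Continuous fun a : ℝ × ℝ => sectorRot i a.1 a.2 := fun i => by
    have : (fun a : ℝ × ℝ => sectorRot i a.1 a.2) = fun a =>
        (sectorPoly i a.1 : ℂ) + ((sectorCoeff i * a.2 : ℝ) : ℂ) * Complex.I := by
      funext a
      apply Complex.ext <;> simp [sectorRot]
    rw [this]
    unfold sectorPoly
    fun_prop
  have h0 := hr 0
  refine ContinuousOn.mul (Continuous.continuousOn (by fun_prop)) ?_
  refine continuousOn_finsetProd _ fun i _ => ContinuousOn.div (hF i).continuousOn ?_ ?_
  · have := hr i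
    exact Continuous.continuousOn (by fun_prop)
  · intro a ha
    exact Complex.ofReal_ne_zero.mpr (radSq_pos i ha).ne'

/-- The vector `N - p_j` in standard position. -/
noncomputable def spoke (j : Fin 6) (x w : ℝ) : Fin 3 → ℝ :=
  ![(zeta j x w).re / √x, (zeta j x w).im / √x, (x + prodCoeff j * √51) / 2 / √x]

/-- The vector `N - S` in standard position. -/
noncomputable def axis (x : ℝ) : Fin 3 → ℝ := ![0, 0, √x]

theorem axis_dot_axis {x : ℝ} (hx : 0 ≤ x) : axis x ⬝ᵥ axis x = x := by
  simp [axis, hx]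

section

variable {x w : ℝ}

theorem spoke_dot_axis (j : Fin 6) (hx : 0 < x) :
    spoke j x w ⬝ᵥ axis x = (x + prodCoeff j * √51) / 2 := by
  have : 0 < √x := Real.sqrt_pos.mpr hx
  simp [spoke, axis]
  field_simp

theorem spoke_dot_self (j : Fin 6) (hx : x ∈ Set.Icc (51 : ℝ) 100) (hw : w ^ 2 = -cubicPoly x) :
    spoke j x w ⬝ᵥ spoke j x w = lenN j ^ 2 := by
  have hx0 : 0 < x := by linarith [hx.1]
  have hs : √x ^ 2 = x := Real.sq_sqrt hx0.le
  have h1 := normSq_zeta j hx hw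
  rw [Complex.normSq_apply, radSq_eq] at h1
  have : 0 < √x := Real.sqrt_pos.mpr hx0
  simp [spoke, dotProduct, Fin.sum_univ_three]
  field_simp
  rw [hs]
  linear_combination 4 * h1

theorem spoke_dot_spoke (j : Fin 6) (hx : x ∈ Set.Icc (51 : ℝ) 100) (hw : w ^ 2 = -cubicPoly x) :
    spoke j x w ⬝ᵥ spoke (j + 1) x w = (lenN j ^ 2 + lenN (j + 1) ^ 2 - lenE j ^ 2) / 2 := by
  have hx0 : 0 < x := by linarith [hx.1]
  have hs : √x ^ 2 = x := Real.sq_sqrt hx0.le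
  have h1 := congrArg Complex.re (conj_zeta_mul_zeta j hx hw)
  simp only [Complex.mul_re, Complex.conj_re, Complex.conj_im, sectorRot,
    sectorPoly_eq_lengths] at h1
  have : 0 < √x := Real.sqrt_pos.mpr hx0
  simp [spoke, dotProduct, Fin.sum_univ_three]
  field_simp
  rw [hs]
  linear_combination 4 * h1

theorem spoke_cross_spoke (j : Fin 6) (hx : x ∈ Set.Icc (51 : ℝ) 100)
    (hw : w ^ 2 = -cubicPoly x) :
    (spoke j x w ⨯₃ spoke (j + 1) x w) ⬝ᵥ axis x = sectorCoeff j * w / √x := by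
  have hx0 : 0 < x := by linarith [hx.1]
  have h1 := congrArg Complex.im (conj_zeta_mul_zeta j hx hw)
  simp only [Complex.mul_im, Complex.conj_re, Complex.conj_im, sectorRot] at h1
  have : 0 < √x := Real.sqrt_pos.mpr hx0
  simp [spoke, axis, cross_apply, dotProduct, Fin.sum_univ_three]
  field_simp
  linear_combination h1

/-- A spoke is determined by the preceding one, its length, height and the orientation. -/
theorem eq_spoke_succ (j : Fin 6) (hx : x ∈ Set.Icc (51 : ℝ) 100) (hw : w ^ 2 = -cubicPoly x)
    {v : Fin 3 → ℝ} (h1 : v ⬝ᵥ axis x = (x + prodCoeff (j + 1) * √51) / 2)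
    (h2 : spoke j x w ⬝ᵥ v = (lenN j ^ 2 + lenN (j + 1) ^ 2 - lenE j ^ 2) / 2)
    (h3 : (spoke j x w ⨯₃ v) ⬝ᵥ axis x = sectorCoeff j * w / √x) :
    v = spoke (j + 1) x w := by
  have hx0 : 0 < x := by linarith [hx.1]
  have hs : 0 < √x := Real.sqrt_pos.mpr hx0
  rw [← spoke_dot_axis (w := w) _ hx0] at h1
  rw [← spoke_dot_spoke j hx hw] at h2
  rw [← spoke_cross_spoke j hx hw] at h3
  have hz := zeta_ne_zero j hx hw
  set u := spoke (j + 1) x w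
  have e2 : v 2 = u 2 := by
    have : v 2 * √x = u 2 * √x := by
      simpa [axis, dotProduct, Fin.sum_univ_three] using h1
    exact mul_right_cancel₀ hs.ne' this
  -- `ha` and `hb` compare the real and imaginary parts of `conj ζ_j * (v₀ + i v₁)`; since `ζ_j ≠
  -- 0`, they determine `v₀` and `v₁`.
  have ha : (zeta j x w).re * v 0 + (zeta j x w).im * v 1 =
      (zeta j x w).re * u 0 + (zeta j x w).im * u 1 := by
    simp only [spoke, dotProduct, Fin.sum_univ_three, e2, Matrix.cons_val] at h2
    field_simp at h2
    linarith
  have hb : (zeta j x w).re * v 1 - (zeta j x w).im * v 0 =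
      (zeta j x w).re * u 1 - (zeta j x w).im * u 0 := by
    simp only [spoke, axis, cross_apply, dotProduct, Fin.sum_univ_three, Matrix.cons_val, mul_zero,
      zero_add] at h3
    field_simp at h3
    linarith
  have hd : (zeta j x w).re ^ 2 + (zeta j x w).im ^ 2 ≠ 0 := by
    have := (Complex.normSq_pos.mpr hz).ne'
    rwa [Complex.normSq_apply, ← sq, ← sq] at this
  have e0 : v 0 = u 0 := mul_left_cancel₀ hd (by
    linear_combination (zeta j x w).re * ha - (zeta j x w).im * hb)
  have e1 : v 1 = u 1 := mul_left_cancel₀ hd (by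
    linear_combination (zeta j x w).im * ha + (zeta j x w).re * hb)
  funext i
  fin_cases i <;> assumption

end

/-! ### Positions in an arbitrary orthonormal frame -/

/-- The position with parameters `x`, `w` in the frame `M` with south pole `s`. -/
noncomputable def position (M : Matrix (Fin 3) (Fin 3) ℝ) (s : E3) (x w : ℝ) : Suspension 6
  | .south => s
  | .north => s + WithLp.toLp 2 (M *ᵥ axis x)
  | .equator j => s + WithLp.toLp 2 (M *ᵥ axis x) - WithLp.toLp 2 (M *ᵥ spoke j x w)

theorem mulVec_dot_mulVec {M : Matrix (Fin 3) (Fin 3) ℝ} (hM : Mᵀ * M = 1) (u v : Fin 3 → ℝ) :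
    (M *ᵥ u) ⬝ᵥ (M *ᵥ v) = u ⬝ᵥ v := by
  rw [Matrix.dotProduct_mulVec, ← Matrix.mulVec_transpose, Matrix.mulVec_mulVec, hM,
    Matrix.one_mulVec]

theorem mulVec_cross_dot (M : Matrix (Fin 3) (Fin 3) ℝ) (u v r : Fin 3 → ℝ) :
    ((M *ᵥ u) ⨯₃ (M *ᵥ v)) ⬝ᵥ (M *ᵥ r) = M.det * ((u ⨯₃ v) ⬝ᵥ r) := by
  simp [Matrix.det_fin_three, cross_apply, Matrix.mulVec, dotProduct, Fin.sum_univ_three]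
  ring

section

variable {M : Matrix (Fin 3) (Fin 3) ℝ} {s : E3} {x w : ℝ}

theorem position_N_sub_S : ((position M s x w).N - (position M s x w).S).ofLp = M *ᵥ axis x := by
  simp [position, Suspension.N, Suspension.S]

theorem position_N_sub_p (j : Fin 6) :
    ((position M s x w).N - (position M s x w).p j).ofLp = M *ᵥ spoke j x w := by
  simp [position, Suspension.N, Suspension.p]

theorem position_poleSq (hM : Mᵀ * M = 1) (hx : 0 ≤ x) : (position M s x w).poleSq = x := by
  rw [Suspension.poleSq, dist_sq_eq_dotProduct, position_N_sub_S, mulVec_dot_mulVec hM,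
    axis_dot_axis hx]

theorem position_lengths (hM : Mᵀ * M = 1) (hx : x ∈ Set.Icc (51 : ℝ) 100)
    (hw : w ^ 2 = -cubicPoly x) (j : Fin 6) :
    dist (position M s x w).N ((position M s x w).p j) = lenN j ∧
    dist ((position M s x w).p j) (position M s x w).S = lenS j ∧
    dist ((position M s x w).p j) ((position M s x w).p (j + 1)) = lenE j := by
  have hx0 : 0 < x := by linarith [hx.1]
  have hN : ∀ i, dist (position M s x w).N ((position M s x w).p i) = lenN i := fun i => by
    rw [← sq_eq_sq₀ dist_nonneg (lenN_pos i).le, dist_sq_eq_dotProduct, position_N_sub_p,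
      mulVec_dot_mulVec hM, spoke_dot_self i hx hw]
  refine ⟨hN j, ?_, ?_⟩
  · have h := dot_edge (N := (position M s x w).N) (p := (position M s x w).p j)
      (q := (position M s x w).S)
    have hP := position_poleSq (s := s) (w := w) hM hx0.le
    rw [Suspension.poleSq] at hP
    rw [position_N_sub_p, position_N_sub_S, mulVec_dot_mulVec hM, spoke_dot_axis j hx0, hN, hP] at h
    rw [← sq_eq_sq₀ dist_nonneg (lenS_pos j).le]
    linear_combination 2 * h + lenN_sq_sub_lenS_sq j
  · have h := dot_edge (N := (position M s x w).N) (p := (position M s x w).p j)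
      (q := (position M s x w).p (j + 1))
    rw [position_N_sub_p, position_N_sub_p, mulVec_dot_mulVec hM, spoke_dot_spoke j hx hw,
      hN, hN] at h
    rw [← sq_eq_sq₀ dist_nonneg (lenE_pos j).le]
    linear_combination 2 * h

theorem isConstructed_position (hM : Mᵀ * M = 1) (hdet : M.det = 1)
    (hx : x ∈ Set.Icc (51 : ℝ) 100) (hw : w ^ 2 = -cubicPoly x) :
    IsConstructed (position M s x w) := by
  refine ⟨position_lengths hM hx hw, SignType.sign w, fun j => ?_⟩
  have hs : 0 < √x := Real.sqrt_pos.mpr (by linarith [hx.1])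
  have hc : SignType.sign (sectorCoeff j) = eps j := by
    have := lenE_pos j
    rw [sectorCoeff, mul_div_assoc, sign_mul, sign_pos (a := lenE j / 2) (by positivity), mul_one]
    fin_cases j <;> simp [eps]
  rw [Suspension.orient, position_N_sub_p, position_N_sub_p, position_N_sub_S, mulVec_cross_dot,
    hdet, one_mul, spoke_cross_spoke j hx hw, div_eq_mul_inv, sign_mul, sign_mul,
    sign_pos (inv_pos.mpr hs), hc, mul_one, mul_comm]

end

/-! ### Every position arises from the family of standard positions -/

/-- Gram–Schmidt: `z` is the unit vector along `r`, `y` the unit vector along the part of `e`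
orthogonal to it, and `y, z × y, z` is a positively oriented orthonormal frame. -/
theorem exists_frame {r e : Fin 3 → ℝ} {a b h : ℝ} (ha : 0 < a) (hb : 0 < b)
    (hr : r ⬝ᵥ r = a ^ 2) (her : e ⬝ᵥ r = h * a) (he : e ⬝ᵥ e = b ^ 2 + h ^ 2) :
    ∃ M : Matrix (Fin 3) (Fin 3) ℝ, Mᵀ * M = 1 ∧ M.det = 1 ∧
      M *ᵥ ![0, 0, a] = r ∧ M *ᵥ ![b, 0, h] = e := by
  obtain ⟨z, rfl⟩ : ∃ z, r = a • z := ⟨a⁻¹ • r, by rw [smul_inv_smul₀ ha.ne']⟩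
  obtain ⟨y, rfl⟩ : ∃ y, e = b • y + h • z :=
    ⟨b⁻¹ • (e - h • z), by rw [smul_inv_smul₀ hb.ne', sub_add_cancel]⟩
  have hzz : z ⬝ᵥ z = 1 := by
    simp only [dotProduct_smul, smul_dotProduct, smul_eq_mul] at hr
    exact mul_left_cancel₀ (pow_ne_zero 2 ha.ne') (by linear_combination hr)
  have hyz : y ⬝ᵥ z = 0 := by
    simp only [dotProduct_smul, smul_dotProduct, smul_eq_mul, add_dotProduct] at her
    exact mul_left_cancel₀ (mul_ne_zero ha.ne' hb.ne') (by linear_combination her - a * h * hzz)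
  have hyy : y ⬝ᵥ y = 1 := by
    have hzy : z ⬝ᵥ y = 0 := by rw [dotProduct_comm, hyz]
    simp only [dotProduct_smul, smul_dotProduct, smul_eq_mul, add_dotProduct, dotProduct_add, hyz,
      hzy, hzz] at he
    exact mul_left_cancel₀ (pow_ne_zero 2 hb.ne') (by linear_combination he)
  -- By Lagrange's identity this is `|z × y|² = 1`, which also gives the determinant.
  have hl : y ⬝ᵥ y * (z ⬝ᵥ z) - (y ⬝ᵥ z) ^ 2 = 1 := by rw [hyy, hzz, hyz]; norm_num
  refine ⟨(Matrix.of ![y, z ⨯₃ y, z])ᵀ, ?_, ?_, ?_, ?_⟩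
  · simp only [dotProduct, Fin.sum_univ_three] at hyy hzz hyz hl
    ext i k
    fin_cases i <;> fin_cases k <;>
      simp [Matrix.mul_apply, Fin.sum_univ_three, cross_apply] <;> linarith
  · simp only [dotProduct, Fin.sum_univ_three] at hl
    simp [Matrix.det_fin_three, cross_apply]
    linarith
  · funext i
    fin_cases i <;> simp [Matrix.mulVec, dotProduct, Fin.sum_univ_three] <;> ring
  · funext i
    fin_cases i <;> simp [Matrix.mulVec, dotProduct, Fin.sum_univ_three] <;> ring

/-! ### Length data alone, and the choice of the branch of `w` -/

/-- The prescribed edge lengths. -/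
def HasLengths (P : Suspension 6) : Prop :=
  ∀ j, dist P.N (P.p j) = lenN j ∧ dist (P.p j) P.S = lenS j ∧
    dist (P.p j) (P.p (j + 1)) = lenE j

theorem HasLengths.isSector {P : Suspension 6} (h : HasLengths P) (j : Fin 6) :
    IsSector j P.N P.S (P.p j) (P.p (j + 1)) where
  north_left := (h j).1
  north_right := (h (j + 1)).1
  south_left := by rw [dist_comm]; exact (h j).2.1
  south_right := by rw [dist_comm]; exact (h (j + 1)).2.1
  edge := (h j).2.2

theorem HasLengths.poleSq_mem {P : Suspension 6} (h : HasLengths P) :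
    P.poleSq ∈ Set.Icc (51 : ℝ) 100 :=
  (h.isSector 0).poleSq_mem

theorem HasLengths.isometric {P Q : Suspension 6} (hP : HasLengths P) (hQ : HasLengths Q) :
    Isometric (suspGraph 6) P Q := by
  have key : ∀ u v : SuspVertex 6, poleEdge u v ∨ equatorEdge u v →
      dist (P u) (P v) = dist (Q u) (Q v) := by
    rintro (_ | _ | i) (_ | _ | j) h <;> simp only [poleEdge, equatorEdge, or_self] at h
    · exact (hP j).1.trans (hQ j).1.symm
    · rw [dist_comm, dist_comm (Q _)]
      exact (hP j).2.1.trans (hQ j).2.1.symm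
    · obtain rfl : j = i + 1 := by simpa using h
      exact (hP i).2.2.trans (hQ i).2.2.symm
  intro u v huv
  rw [suspGraph, SimpleGraph.fromRel_adj] at huv
  rcases huv.2 with h | h
  · exact key u v h
  · rw [dist_comm, dist_comm (Q u)]
    exact key v u h

theorem HasLengths.of_isometric {P Q : Suspension 6} (hP : HasLengths P)
    (h : Isometric (suspGraph 6) P Q) : HasLengths Q := by
  intro j
  have hN := h .north (.equator j) (by simp [suspGraph, poleEdge])
  have hS := h (.equator j) .south (by simp [suspGraph, poleEdge])
  have hE := h (.equator j) (.equator (j + 1)) (by simp [suspGraph, equatorEdge])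
  exact ⟨hN.symm.trans (hP j).1, hS.symm.trans (hP j).2.1, hE.symm.trans (hP j).2.2⟩

/-- The parameter `w` as a function of `x`, on one of the two branches. -/
noncomputable def branch (τ x : ℝ) : ℝ := τ * √(-cubicPoly x)

theorem neg_cubicPoly_nonneg {x : ℝ} (hx : x ∈ Set.Icc (51 : ℝ) 100) : 0 ≤ -cubicPoly x := by
  have : 0 ≤ x * (x - 51) * (100 - x) :=
    mul_nonneg (mul_nonneg (by linarith [hx.1]) (by linarith [hx.1])) (by linarith [hx.2])
  unfold cubicPoly
  linarith

theorem branch_sq {τ x : ℝ} (hτ : τ ^ 2 = 1) (hx : x ∈ Set.Icc (51 : ℝ) 100) :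
    branch τ x ^ 2 = -cubicPoly x := by
  rw [branch, mul_pow, hτ, one_mul, Real.sq_sqrt (neg_cubicPoly_nonneg hx)]

/-- The lengths give every determinant up to sign by `det_sq`. The sign condition with a common `σ`
makes the six choices coherent, so one branch of `w` serves all sectors. -/
theorem exists_branch {P : Suspension 6} (hP : IsConstructed P) : ∃ τ : ℝ, τ ^ 2 = 1 ∧
    ∀ j, ((P.N - P.p j).ofLp ⨯₃ (P.N - P.p (j + 1)).ofLp) ⬝ᵥ (P.N - P.S).ofLp =
      sectorCoeff j * branch τ P.poleSq / √P.poleSq := by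
  obtain ⟨hlen, σ, hσ⟩ := hP
  have hlen : HasLengths P := hlen
  have hx := hlen.poleSq_mem
  have hx0 : 0 < P.poleSq := by linarith [hx.1]
  have habs : ∀ (τ : ℝ), τ ^ 2 = 1 → ∀ j,
      |((P.N - P.p j).ofLp ⨯₃ (P.N - P.p (j + 1)).ofLp) ⬝ᵥ (P.N - P.S).ofLp| =
        |sectorCoeff j * branch τ P.poleSq / √P.poleSq| := by
    intro τ hτ j
    rw [← sq_eq_sq_iff_abs_eq_abs, (hlen.isSector j).det_sq, div_pow, mul_pow, sectorCoeff_sq,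
      branch_sq hτ hx, Real.sq_sqrt hx0.le, cubicPoly, Suspension.poleSq]
    rw [Suspension.poleSq] at hx0
    generalize dist P.N P.S ^ 2 = y at hx0 ⊢
    field_simp
  have hcoeff : ∀ (τ : ℝ), τ ^ 2 = 1 → ∀ j, sectorCoeff j * branch τ P.poleSq / √P.poleSq =
      τ * (eps j : ℝ) * |sectorCoeff j * branch τ P.poleSq / √P.poleSq| := by
    intro τ hτ j
    have hE := lenE_pos j
    have h1 : |τ| = 1 := by rw [← sq_abs] at hτ; nlinarith [abs_nonneg τ]
    have h2 : |(eps j : ℝ)| = 1 := by fin_cases j <;> simp [eps]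
    rw [abs_div, abs_mul, abs_of_nonneg (Real.sqrt_nonneg P.poleSq), branch, abs_mul, h1,
      sectorCoeff, abs_div, abs_mul, h2, abs_of_pos hE, abs_of_nonneg (Real.sqrt_nonneg _), abs_two]
    ring
  have hself : ∀ j, ((P.N - P.p j).ofLp ⨯₃ (P.N - P.p (j + 1)).ofLp) ⬝ᵥ (P.N - P.S).ofLp =
      ((σ : SignType) : ℝ) * (eps j : ℝ) *
        |((P.N - P.p j).ofLp ⨯₃ (P.N - P.p (j + 1)).ofLp) ⬝ᵥ (P.N - P.S).ofLp| := by
    intro j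
    have h := hσ j
    rw [Suspension.orient] at h
    have h' := (sign_mul_abs
      (((P.N - P.p j).ofLp ⨯₃ (P.N - P.p (j + 1)).ofLp) ⬝ᵥ (P.N - P.S).ofLp)).symm
    rwa [h, SignType.coe_mul] at h'
  have hnonzero : ∀ τ : ℝ, τ ^ 2 = 1 → (σ : ℝ) = τ → ∃ τ : ℝ, τ ^ 2 = 1 ∧
      ∀ j, ((P.N - P.p j).ofLp ⨯₃ (P.N - P.p (j + 1)).ofLp) ⬝ᵥ (P.N - P.S).ofLp =
        sectorCoeff j * branch τ P.poleSq / √P.poleSq := by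
    intro τ hτ hστ
    refine ⟨τ, hτ, fun j => ?_⟩
    rw [hself j, hcoeff τ hτ j, hστ, habs τ hτ j]
  cases σ with
  | zero =>
    -- In a flat position the right side vanishes as well, so either branch would do.
    refine ⟨1, by norm_num, fun j => ?_⟩
    have h := hself j
    simp only [SignType.zero_eq_zero, SignType.coe_zero, zero_mul] at h
    have h2 := habs 1 (by norm_num) j
    rw [h, abs_zero] at h2
    rw [h, abs_eq_zero.mp h2.symm]
  | neg => exact hnonzero (-1) (by norm_num) (by simp)
  | pos => exact hnonzero 1 (by norm_num) (by simp)

/-- A position is congruent to a standard one by a motion. -/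
theorem exists_eq_position {P : Suspension 6} (hP : IsConstructed P) :
    ∃ (M : Matrix (Fin 3) (Fin 3) ℝ) (τ : ℝ), Mᵀ * M = 1 ∧ M.det = 1 ∧ τ ^ 2 = 1 ∧
      P = position M P.S P.poleSq (branch τ P.poleSq) := by
  obtain ⟨τ, hτ, hdet⟩ := exists_branch hP
  have hlen : HasLengths P := hP.1
  have hx := hlen.poleSq_mem
  have hw := branch_sq hτ hx
  have hx0 : 0 < P.poleSq := by linarith [hx.1]
  have hs : 0 < √P.poleSq := Real.sqrt_pos.mpr hx0
  have hq := radSq_pos 0 hx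
  have hax : ∀ j, (P.N - P.p j).ofLp ⬝ᵥ (P.N - P.S).ofLp = (P.poleSq + prodCoeff j * √51) / 2 :=
    fun j => dot_axis (hlen.isSector j).north_left (hlen.isSector j).south_left
  have hrr : (P.N - P.S).ofLp ⬝ᵥ (P.N - P.S).ofLp = √P.poleSq ^ 2 := by
    rw [← dist_sq_eq_dotProduct, Real.sq_sqrt hx0.le, Suspension.poleSq]
  -- `ζ_0` is real and positive, so the first frame vector has to point along the projection of
  -- `e_0`.
  have hsp : spoke 0 P.poleSq (branch τ P.poleSq) = ![√(radSq 0 P.poleSq) / √P.poleSq, 0,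
      (P.poleSq + prodCoeff 0 * √51) / 2 / √P.poleSq] := by
    simp [spoke, zeta_zero]
  obtain ⟨M, hM, hM1, hMr, hMe⟩ := exists_frame hs
    (div_pos (Real.sqrt_pos.mpr hq) hs) hrr
    (h := (P.poleSq + prodCoeff 0 * √51) / 2 / √P.poleSq)
    (e := (P.N - P.p 0).ofLp) (by rw [hax, div_mul_cancel₀ _ hs.ne']) (by
      rw [← dist_sq_eq_dotProduct, (hlen 0).1, div_pow, div_pow, Real.sq_sqrt hq.le,
        Real.sq_sqrt hx0.le, radSq_eq]
      field_simp
      ring)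
  rw [← hsp] at hMe
  -- Once the frame matches `R` and `e_0`, rigidity of each sector with given `x` and orientation
  -- propagates the match around the equator.
  have hstep : ∀ j, M *ᵥ spoke j P.poleSq (branch τ P.poleSq) = (P.N - P.p j).ofLp →
      M *ᵥ spoke (j + 1) P.poleSq (branch τ P.poleSq) = (P.N - P.p (j + 1)).ofLp := by
    intro j hj
    obtain ⟨v, hv⟩ : ∃ v, M *ᵥ v = (P.N - P.p (j + 1)).ofLp :=
      ⟨Mᵀ *ᵥ (P.N - P.p (j + 1)).ofLp, by
        rw [Matrix.mulVec_mulVec, mul_eq_one_comm.mp hM, Matrix.one_mulVec]⟩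
    have hMr : M *ᵥ axis P.poleSq = (P.N - P.S).ofLp := hMr
    rw [← hv]
    congr 1
    refine (eq_spoke_succ j hx hw ?_ ?_ ?_).symm
    · rw [← mulVec_dot_mulVec hM, hv, hMr, hax]
    · rw [← mulVec_dot_mulVec hM, hv, hj, dot_edge, (hlen j).1, (hlen (j + 1)).1, (hlen j).2.2]
    · rw [← hdet j, ← hj, ← hv, ← hMr, mulVec_cross_dot, hM1, one_mul]
  have hall : ∀ j, M *ᵥ spoke j P.poleSq (branch τ P.poleSq) = (P.N - P.p j).ofLp := by
    have h1 := hstep 0 hMe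
    have h2 := hstep 1 h1
    have h3 := hstep 2 h2
    have h4 := hstep 3 h3
    have h5 := hstep 4 h4
    intro j
    fin_cases j <;> assumption
  have hnorth : P.S + WithLp.toLp 2 (M *ᵥ axis P.poleSq) = P.N := by
    rw [axis, hMr, WithLp.toLp_ofLp, add_sub_cancel]
  refine ⟨M, τ, hM, hM1, hτ, ?_⟩
  funext v
  rcases v with _ | _ | j
  · exact hnorth.symm
  · rfl
  · simp only [position]
    rw [hnorth, hall, WithLp.toLp_ofLp, sub_sub_cancel]
    rfl

/-! ### The flex -/

theorem continuous_position {T : Type*} [TopologicalSpace T] (M : Matrix (Fin 3) (Fin 3) ℝ) (s : E3)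
    {f g : T → ℝ} (hf : Continuous f) (hg : Continuous g)
    (hI : ∀ t, f t ∈ Set.Icc (51 : ℝ) 100) : Continuous fun t => position M s (f t) (g t) := by
  have hax : Continuous fun t => WithLp.toLp 2 (M *ᵥ axis (f t)) := by
    refine (PiLp.continuous_toLp 2 _).comp (Continuous.matrix_mulVec continuous_const ?_)
    refine continuous_pi fun i => ?_
    fin_cases i <;> simp [axis] <;> fun_prop
  have hsp : ∀ j, Continuous fun t => WithLp.toLp 2 (M *ᵥ spoke j (f t) (g t)) := by
    intro j
    have hz : Continuous fun t => zeta j (f t) (g t) :=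
      (continuousOn_zeta j).comp_continuous (hf.prodMk hg) hI
    have hs : ∀ t, √(f t) ≠ 0 := fun t => (Real.sqrt_pos.mpr (by linarith [(hI t).1])).ne'
    refine (PiLp.continuous_toLp 2 _).comp (Continuous.matrix_mulVec continuous_const ?_)
    refine continuous_pi fun i => ?_
    fin_cases i
    · exact (Complex.continuous_re.comp hz).div (by fun_prop) hs
    · exact (Complex.continuous_im.comp hz).div (by fun_prop) hs
    · exact Continuous.div (by fun_prop) (by fun_prop) hs
  refine continuous_pi fun v => ?_
  rcases v with _ | _ | j
  · exact continuous_const.add hax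
  · exact continuous_const
  · exact (continuous_const.add hax).sub (hsp j)

/-- A path in `[51, 100]` that starts at `a`, descends to `51` and then ascends to `100`. -/
noncomputable def sweep (a : ℝ) (t : unitInterval) : ℝ :=
  max (a - 2 * (a - 51) * t) (51 + 49 * (2 * t - 1))

theorem continuous_sweep (a : ℝ) : Continuous (sweep a) := by
  unfold sweep
  fun_prop

theorem sweep_zero {a : ℝ} (ha : a ∈ Set.Icc (51 : ℝ) 100) : sweep a 0 = a := by
  simp only [sweep, Set.Icc.coe_zero]
  rw [max_eq_left] <;> linarith [ha.1]

theorem sweep_mem {a : ℝ} (ha : a ∈ Set.Icc (51 : ℝ) 100) (t : unitInterval) :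
    sweep a t ∈ Set.Icc (51 : ℝ) 100 := by
  obtain ⟨t, h0, h1⟩ := t
  obtain ⟨ha1, ha2⟩ := ha
  have h := mul_nonneg h0 (sub_nonneg.mpr ha1)
  refine ⟨?_, max_le ?_ ?_⟩
  · rcases le_total t (1 / 2) with ht | ht
    · have := mul_nonneg (sub_nonneg.mpr ht) (sub_nonneg.mpr ha1)
      exact le_max_of_le_left (by linarith)
    · exact le_max_of_le_right (by linarith)
  · dsimp only
    linarith
  · dsimp only
    linarith

theorem range_sweep {a : ℝ} (ha : a ∈ Set.Icc (51 : ℝ) 100) :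
    Set.range (sweep a) = Set.Icc (51 : ℝ) 100 := by
  apply Set.Subset.antisymm
  · rintro _ ⟨t, rfl⟩
    exact sweep_mem ha t
  -- The lowest point `51` is reached at `t = 1/2` and the value `100` at `t = 1`.
  · have h := intermediate_value_univ (⟨1 / 2, by norm_num, by norm_num⟩ : unitInterval) 1
      (continuous_sweep a)
    have h1 : sweep a ⟨1 / 2, by norm_num, by norm_num⟩ = 51 := by
      simp only [sweep]
      rw [max_eq_left] <;> linarith
    have h2 : sweep a 1 = 100 := by
      simp only [sweep, Set.Icc.coe_one]
      rw [max_eq_right] <;> linarith [ha.1]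
    rwa [h1, h2] at h

theorem exists_flex {P : Suspension 6} (hP : IsConstructed P) :
    ∃ γ : unitInterval → Suspension 6, IsIsometricDeformation (suspGraph 6) P γ ∧
      (∀ t, IsConstructed (γ t)) ∧ Set.range (fun t => (γ t).poleSq) = Set.Icc 51 100 := by
  obtain ⟨M, τ, hM, hdet, hτ, hPe⟩ := exists_eq_position hP
  have hx : P.poleSq ∈ Set.Icc (51 : ℝ) 100 := HasLengths.poleSq_mem hP.1
  have hmem := sweep_mem hx
  have hcon : ∀ t, IsConstructed (position M P.S (sweep P.poleSq t)
      (branch τ (sweep P.poleSq t))) := fun t =>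
    isConstructed_position hM hdet (hmem t) (branch_sq hτ (hmem t))
  have hcs := continuous_sweep P.poleSq
  refine ⟨fun t => position M P.S (sweep P.poleSq t) (branch τ (sweep P.poleSq t)),
    ⟨?_, ?_, fun t => HasLengths.isometric (hcon 0).1 (hcon t).1⟩, hcon, ?_⟩
  · refine continuous_position M P.S hcs ?_ hmem
    unfold branch cubicPoly
    fun_prop
  · simp only [sweep_zero hx]
    exact hPe.symm
  · rw [← range_sweep hx]
    congr 1
    funext t
    exact position_poleSq hM (by linarith [(hmem t).1])

theorem Congruent.poleSq_eq {n : ℕ} {P Q : Suspension n} (h : Congruent P Q) :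
    P.poleSq = Q.poleSq := by
  obtain ⟨A, hA⟩ := h
  simp only [Suspension.poleSq, Suspension.N, Suspension.S, hA, A.isometry.dist_eq]

theorem flexible_of_isConstructed {P : Suspension 6} (hP : IsConstructed P) :
    Flexible (suspGraph 6) P := by
  obtain ⟨γ, hγ, -, hr⟩ := exists_flex hP
  refine ⟨γ, hγ, ?_⟩
  -- Congruence preserves the pole distance, but the flex attains both `x = 51` and `x = 100`.
  by_contra! hc
  have h1 : (51 : ℝ) ∈ Set.range fun t => (γ t).poleSq := by rw [hr]; norm_num
  have h2 : (100 : ℝ) ∈ Set.range fun t => (γ t).poleSq := by rw [hr]; norm_num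
  obtain ⟨t, ht⟩ := h1
  obtain ⟨s, hs⟩ := h2
  have := ((hc t).poleSq_eq.symm.trans (hc s).poleSq_eq)
  simp only [ht, hs] at this
  norm_num at this

/-- The standard position. -/
theorem isConstructed_standard {x : ℝ} (hx : x ∈ Set.Icc (51 : ℝ) 100) :
    IsConstructed (position 1 0 x (branch 1 x)) :=
  isConstructed_position (by simp) (by simp) hx (branch_sq (by norm_num) hx)

theorem sectorPoleSq_eq (j : Fin 6) : sectorPoleSq j = Set.Icc 51 100 := by
  apply Set.Subset.antisymm
  · rintro x ⟨N, S, p, q, h1, h2, h3, h4, h5, rfl⟩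
    exact IsSector.poleSq_mem ⟨h1, h2, h3, h4, h5⟩
  · intro x hx
    have hP := isConstructed_standard hx
    have h := HasLengths.isSector hP.1 j
    refine ⟨_, _, _, _, h.north_left, h.north_right, h.south_left, h.south_right, h.edge, ?_⟩
    exact (position_poleSq (by simp) (by linarith [hx.1])).symm

/-! ### Non-triviality -/

/-- Only the last subdivision is needed: its new vertex lies between its neighbours. Subtracting
Stewart's relation seen from `S` from the one seen from `N` leaves a linear relation between the `ℓ²
- ℓ'²`; divided by `√51` it is rational and contradicts `stewart_ne`. -/
theorem HasLengths.not_isSubdividedBricard {P : Suspension 6} (h : HasLengths P) :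
    ¬ IsSubdividedBricard P := by
  rintro ⟨-, -, -, -, -, -, k, hk, -⟩
  have hN := stewart hk P.N
  have hS := stewart hk P.S
  have hE : dist (P.p (k - 1)) (P.p k) = lenE (k - 1) := by
    simpa using (h (k - 1)).2.2
  rw [hE, (h k).2.2, (h _).1, (h _).1, (h _).1] at hN
  rw [hE, (h k).2.2, dist_comm, (h _).2.1, dist_comm, (h _).2.1, dist_comm, (h _).2.1] at hS
  refine stewart_ne k (mul_right_cancel₀ (b := √51) (by positivity) ?_)
  linear_combination hN - hS - lenE k * lenN_sq_sub_lenS_sq (k - 1) -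
    lenE (k - 1) * lenN_sq_sub_lenS_sq (k + 1) +
    (lenE (k - 1) + lenE k) * lenN_sq_sub_lenS_sq k

theorem HasLengths.not_isDoublyCoveredStar {P : Suspension 6} (h : HasLengths P) :
    ¬ IsDoublyCoveredStar P := by
  rintro ⟨Q, rfl⟩
  exact (dist_poles_pos (h.isSector 0).north_left (h.isSector 0).south_left).ne' (dist_self Q.N)

theorem hasAbscissa_ptQ (j : Fin 6) : HasAbscissa (ptQ j) (sumSq j) := by
  fin_cases j
  exacts [isPoint_ptQ_zero.hasAbscissa, isPoint_ptQ_one.hasAbscissa, isPoint_ptQ_two.hasAbscissa,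
    isPoint_ptQ_three.hasAbscissa, isPoint_ptQ_four.hasAbscissa, isPoint_ptQ_five.hasAbscissa]

theorem hasAbscissa_ptQ' (j : Fin 6) : HasAbscissa (ptQ' j) (diffSq j) := by
  fin_cases j
  exacts [isPoint_ptB.neg.hasAbscissa, isPoint_ptD.hasAbscissa, isPoint_ptA.neg.hasAbscissa,
    isPoint_ptB.hasAbscissa, isPoint_ptD.neg.hasAbscissa, isPoint_ptA.hasAbscissa]

end FlexSusp

open FlexSusp
theorem mainTheorem1 :
    -- the edge lengths come from the points `A`, `B`, `C`, `D` of the cubic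
    (∀ j, HasAbscissa (ptQ j) ((lenN j + lenS j) ^ 2) ∧
      HasAbscissa (ptQ' j) ((lenN j - lenS j) ^ 2)) ∧
    (∀ j, sectorPoleSq j = Set.Icc 51 100) ∧
    -- the suspension exists, in each of its positions it flexes, and it is non-trivial
    (∃ P : Suspension 6, IsConstructed P) ∧
    ∀ P : Suspension 6, IsConstructed P →
      Flexible (suspGraph 6) P ∧
      (∃ γ : unitInterval → Suspension 6, IsIsometricDeformation (suspGraph 6) P γ ∧
        (∀ t, IsConstructed (γ t)) ∧
        Set.range (fun t => (γ t).poleSq) = Set.Icc 51 100) ∧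
      ∀ P' : Suspension 6, Isometric (suspGraph 6) P P' →
        P'.poleSq ∈ Set.Icc 51 100 ∧ ¬ IsSubdividedBricard P' ∧ ¬ IsDoublyCoveredStar P' := by
  refine ⟨fun j => ?_, sectorPoleSq_eq,
    ⟨_, isConstructed_standard (Set.left_mem_Icc.mpr (by norm_num))⟩,
    fun P hP => ⟨flexible_of_isConstructed hP, exists_flex hP, fun P' hP' => ?_⟩⟩
  · rw [lenN_add_lenS_sq, lenN_sub_lenS_sq]
    exact ⟨hasAbscissa_ptQ j, hasAbscissa_ptQ' j⟩
  · have h := HasLengths.of_isometric hP.1 hP'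
    exact ⟨h.poleSq_mem, h.not_isSubdividedBricard, h.not_isDoublyCoveredStar⟩
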